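/- Let $\mathcal H_A,\mathcal H_B$ be complex Hilbert spaces of finite dimensions $d_A,d_B$, and let $\mathscr B=\{\mathcal B_x\}_{x=1}^m$, $\mathcal B_x=\{|\psi_{xk}\rangle\}_{k=1}^{d_A}$, be a finite family of orthonormal bases of $\mathcal H_A$. The transition graph of $\mathscr B$ has one vertex $(x,k)$ for each basis state $|\psi_{xk}\rangle$ (equal states in different bases give different vertices), and two different vertices $(x,k)$, $(y,l)$ are adjacent iff $\langle\psi_{xk}|\psi_{yl}\rangle\neq 0$. The family $\mathscr B$ is irreducible if this graph is connected (in particular nonempty). A bipartite state is a positive semidefinite operator of trace one on $\mathcal H_A\otimes\mathcal H_B$ (pure or mixed). A state $\rho$ is a zero-uncertainty state (ZUS) with respect to $\mathscr B$ if for every $x$ there is a POVM $\{\Pi_{xk}\}_{k=1}^{d_A}$ on $\mathcal H_B$ such that $$\sum_{k}\operatorname{tr}\bigl[\rho\,(|\psi_{xk}\rangle\langle\psi_{xk}|\otimes\Pi_{xk})\bigr]=1 .$$ A state $\rho$ on $\mathcal H_A\otimes\mathcal H_B$ is a maximally entangled state (MES) if every state on $\mathcal H_A\otimes\mathcal H_B$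 can be created from $\rho$ by local operations and two-way classical communication (LOCC), with finitely many rounds, finitely many measurement outcomes in each round, and arbitrary finite-dimensional local ancillas. **Theorem.** Suppose $\mathscr B$ is irreducible. Then a bipartite (pure or mixed) state $\rho$ on $\mathcal H_A\otimes\mathcal H_B$ is a ZUS with respect to $\mathscr B$ if and only if $d_B\ge d_A$ and $\rho$ is a MES. -/

import Mathlib

open scoped Matrix Kronecker ComplexOrder

noncomputable section

/-- Operators on the bipartite system `ℂ^a ⊗ ℂ^b`, as matrices in the product basis. -/
abbrev BipartiteOp (a b : ℕ) : Type := Matrix (Fin a × Fin b) (Fin a × Fin b) ℂ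

/-- A bipartite quantum state, pure or mixed: a positive semidefinite operator of trace one. -/
def IsState {a b : ℕ} (ρ : BipartiteOp a b) : Prop :=
  ρ.PosSemidef ∧ ρ.trace = 1

/-- The rank-one operator `|ψ⟩⟨ψ|`. -/
def ketBra {d : ℕ} (ψ : EuclideanSpace ℂ (Fin d)) : Matrix (Fin d) (Fin d) ℂ :=
  Matrix.of fun i j => ψ i * star (ψ j)

/-- A set of `m` orthonormal bases of `ℂ^d`, where `B x k` is the `k`-th vector of basis `x`. -/
abbrev BasisSet (m d : ℕ) : Type :=
  Fin m → OrthonormalBasis (Fin d) ℂ (EuclideanSpace ℂ (Fin d))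

/-- The transition graph of a basis set. The vertices are the `m * d` basis states (equal states
in different bases are different vertices); two different vertices are adjacent iff the
corresponding states are not orthogonal. -/
def transitionGraph {m d : ℕ} (B : BasisSet m d) : SimpleGraph (Fin m × Fin d) where
  Adj v w := v ≠ w ∧ inner ℂ (B v.1 v.2) (B w.1 w.2) ≠ 0
  symm := ⟨fun _ _ h => ⟨h.1.symm, fun h0 => h.2 (inner_eq_zero_symm.mp h0)⟩⟩
  loopless := ⟨fun _ h => h.1 rfl⟩

/-- A basis set is irreducible if its transition graph is connected. -/
def IsIrreducibleBasisSet {m d : ℕ} (B : BasisSet m d) : Prop :=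
  (transitionGraph B).Connected

/-- A POVM on `ℂ^b` with outcomes in `Fin n`. -/
def IsPOVM {n b : ℕ} (E : Fin n → Matrix (Fin b) (Fin b) ℂ) : Prop :=
  (∀ k, (E k).PosSemidef) ∧ ∑ k, E k = 1

/-- The probability `∑ k, tr[ρ (|ψ k⟩⟨ψ k| ⊗ E k)]` that Bob, measuring the POVM `E`, correctly
guesses the outcome of Alice's projective measurement in the orthonormal basis `ψ`. -/
def guessProb {a b : ℕ} (ρ : BipartiteOp a b)
    (ψ : OrthonormalBasis (Fin a) ℂ (EuclideanSpace ℂ (Fin a)))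
    (E : Fin a → Matrix (Fin b) (Fin b) ℂ) : ℂ :=
  ∑ k, (ρ * (ketBra (ψ k) ⊗ₖ E k)).trace

/-- `ρ` is a zero-uncertainty state for `B`: for every basis that Alice may choose, Bob has a
measurement that predicts her outcome with certainty. -/
def IsZUS {m a b : ℕ} (B : BasisSet m a) (ρ : BipartiteOp a b) : Prop :=
  ∀ x, ∃ E : Fin a → Matrix (Fin b) (Fin b) ℂ, IsPOVM E ∧ guessProb ρ (B x) E = 1

/-- The maps from operators on `ℂ^a ⊗ ℂ^b` to operators on `ℂ^c ⊗ ℂ^d` that are implemented by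
local operations and (two-way) classical communication with finitely many rounds.
A protocol either stops, or one party performs a local measurement given by finitely many Kraus
operators `K i` with `∑ i, (K i)ᴴ * K i = 1` (possibly changing the local dimension, so that
ancillas can be added and subsystems discarded) and announces the outcome `i`, after which the
two parties continue with a protocol that may depend on `i`. Outcomes are forgotten at the end.
A general local instrument, with several Kraus operators per outcome, is the case where the
continuation is the same for several values of `i`. -/
inductive IsLOCC {c d : ℕ} : {a b : ℕ} → (BipartiteOp a b → BipartiteOp c d) → Prop
  | done : IsLOCC (a := c) (b := d) (fun ρ => ρ)
  | alice {a b n : ℕ} (dim : Fin n → ℕ) (K : (i : Fin n) → Matrix (Fin (dim i)) (Fin a) ℂ)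
      (hK : ∑ i, (K i)ᴴ * K i = 1)
      (T : (i : Fin n) → BipartiteOp (dim i) b → BipartiteOp c d)
      (hT : ∀ i, IsLOCC (T i)) :
      IsLOCC (a := a) (b := b) (fun ρ => ∑ i, T i
        ((K i ⊗ₖ (1 : Matrix (Fin b) (Fin b) ℂ)) * ρ *
          (K i ⊗ₖ (1 : Matrix (Fin b) (Fin b) ℂ))ᴴ))
  | bob {a b n : ℕ} (dim : Fin n → ℕ) (K : (i : Fin n) → Matrix (Fin (dim i)) (Fin b) ℂ)
      (hK : ∑ i, (K i)ᴴ * K i = 1)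
      (T : (i : Fin n) → BipartiteOp a (dim i) → BipartiteOp c d)
      (hT : ∀ i, IsLOCC (T i)) :
      IsLOCC (a := a) (b := b) (fun ρ => ∑ i, T i
        (((1 : Matrix (Fin a) (Fin a) ℂ) ⊗ₖ K i) * ρ *
          ((1 : Matrix (Fin a) (Fin a) ℂ) ⊗ₖ K i)ᴴ))

/-- A state on `ℂ^a ⊗ ℂ^b` is maximally entangled if every state on `ℂ^a ⊗ ℂ^b` can be created
from it by LOCC. -/
def IsMES {a b : ℕ} (ρ : BipartiteOp a b) : Prop :=
  IsState ρ ∧ ∀ σ : BipartiteOp a b, IsState σ →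
    ∃ T : BipartiteOp a b → BipartiteOp a b, IsLOCC T ∧ T ρ = σ

end

/-!
Vectors of `ℂ^a ⊗ ℂ^b` are `b × a` matrices, on which `A ⊗ K` acts by `N ↦ K N Aᵀ`. If Bob predicts
Alice's outcomes with certainty, then every vector `N` of an ensemble decomposition of `ρ` satisfies
`E k * N = N * (ketBra (ψ k))ᵀ`. Hence the Gram operators `(N s)ᴴ * N t` of the ensemble commute,
after transposition, with all basis projectors, and connectedness of the transition graph makes them
scalar. For an orthogonal ensemble this means that `ρ` is a mixture of maximally entangled vectors
that Bob can tell apart. He can then project onto one of them and teleport any target state by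
sending the resulting index of a Weyl operator, so `ρ` is maximally entangled.

Conversely, an LOCC map has product Kraus operators. If it creates the pure maximally entangled
vector `J` from `ρ`, extremality of the pure state forces each of them to send every vector of an
ensemble to a multiple of `J`, and again the Gram operators are scalar. Such a mixture is perfectly
predictable for every basis: Bob measures which vector he shares and the conjugate basis.
-/

open Matrix

section RankOne

variable {m n ι R : Type*} [CommRing R] [StarRing R]

/-- The rank-one operator `|N⟩⟩⟨⟨N|` of the vectorization of a matrix `N`. Vectorization is
column-major, so Alice's index is the column index of `N` and Bob's is the row index. -/
def vecKetBra (N : Matrix n m R) : Matrix (m × n) (m × n) R :=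
  vecMulVec N.vec (star N.vec)

@[simp]
theorem vecKetBra_zero : vecKetBra (0 : Matrix n m R) = 0 := by
  rw [vecKetBra, vec_zero, zero_vecMulVec]

theorem vecKetBra_smul (z : R) (N : Matrix n m R) :
    vecKetBra (z • N) = (z * star z) • vecKetBra N := by
  rw [vecKetBra, vecKetBra, vec_smul, star_smul, smul_vecMulVec, vecMulVec_smul, smul_smul]

variable [Fintype m] [Fintype n]

theorem kronecker_mul_vecKetBra_mul {m' n' : Type*} (A : Matrix m' m R) (B : Matrix n' n R)
    (N : Matrix n m R) :
    (A ⊗ₖ B) * vecKetBra N * (A ⊗ₖ B)ᴴ = vecKetBra (B * N * Aᵀ) := by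
  rw [vecKetBra, vecKetBra, mul_vecMulVec, vecMulVec_mul, ← star_mulVec, kronecker_mulVec_vec]

theorem trace_vecKetBra (N : Matrix n m R) : (vecKetBra N).trace = (Nᴴ * N).trace := by
  rw [vecKetBra, trace_vecMulVec, dotProduct_comm, star_vec_dotProduct_vec]

theorem trace_sum_vecMulVec_star_mul [Fintype ι] (v : ι → n → R) (M : Matrix n n R) :
    ((∑ i, vecMulVec (v i) (star (v i))) * M).trace = ∑ i, star (v i) ⬝ᵥ M *ᵥ v i := by
  rw [Matrix.sum_mul, trace_sum]
  refine Finset.sum_congr rfl fun i _ => ?_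
  rw [vecMulVec_mul, trace_vecMulVec, dotProduct_comm, dotProduct_mulVec]

end RankOne

section Ensembles

variable {m n ι 𝕜 : Type*} [RCLike 𝕜] [Fintype m] [Fintype n] [Fintype ι]

theorem mulVec_eq_zero_of_trace_sum_mul_eq_zero {v : ι → n → 𝕜} {M : Matrix n n 𝕜}
    (hM : M.PosSemidef) (h : ((∑ i, vecMulVec (v i) (star (v i))) * M).trace = 0) (i : ι) :
    M *ᵥ v i = 0 := by
  rw [trace_sum_vecMulVec_star_mul,
    Finset.sum_eq_zero_iff_of_nonneg fun i _ => hM.dotProduct_mulVec_nonneg (v i)] at h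
  exact (hM.dotProduct_mulVec_zero_iff _).1 (h i (Finset.mem_univ i))

theorem exists_eq_smul_of_sum_vecMulVec_eq {d : Type*} [Finite d] {v : ι → d → 𝕜} {w : d → 𝕜}
    {r : 𝕜} (h : ∑ i, vecMulVec (v i) (star (v i)) = r • vecMulVec w (star w)) (i : ι) :
    ∃ z : 𝕜, v i = z • w := by
  have := Fintype.ofFinite d
  have orthogonal_of_orthogonal (x : d → 𝕜) (hx : star w ⬝ᵥ x = 0) : star x ⬝ᵥ v i = 0 := by
    have htrace : ((∑ i, vecMulVec (v i) (star (v i))) * vecMulVec x (star x)).trace = 0 := by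
      rw [h, Matrix.smul_mul, vecMulVec_mul_vecMulVec, hx, zero_smul, vecMulVec_zero, smul_zero,
        trace_zero]
    have hzero : (star x ⬝ᵥ v i) • x = 0 := by
      simpa [vecMulVec_mulVec] using
        mulVec_eq_zero_of_trace_sum_mul_eq_zero (posSemidef_vecMulVec_self_star x) htrace i
    rcases smul_eq_zero.1 hzero with hx | rfl
    · exact hx
    · rw [star_zero, zero_dotProduct]
  let z := (star w ⬝ᵥ v i) / (star w ⬝ᵥ w)
  let x := v i - z • w
  have hwx : star w ⬝ᵥ x = 0 := by
    rw [dotProduct_sub, dotProduct_smul, smul_eq_mul, sub_eq_zero]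
    by_cases hw : star w ⬝ᵥ w = 0
    · rw [dotProduct_star_self_eq_zero.1 hw]
      simp only [star_zero, zero_dotProduct, mul_zero]
    · rw [div_mul_cancel₀ _ hw]
  have hxx : star x ⬝ᵥ x = 0 := by
    have hxw : star x ⬝ᵥ w = 0 := by rw [star_dotProduct, hwx, star_zero]
    rw [dotProduct_sub, dotProduct_smul, hxw, orthogonal_of_orthogonal x hwx,
      smul_zero, sub_zero]
  exact ⟨z, sub_eq_zero.1 (dotProduct_star_self_eq_zero.1 hxx)⟩

theorem sum_vecMulVec_orthonormalBasis [DecidableEq n]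
    (b : OrthonormalBasis ι 𝕜 (EuclideanSpace 𝕜 n)) :
    ∑ i, vecMulVec (b i).ofLp (star (b i).ofLp) = 1 := by
  have h := congrArg (fun f => toEuclideanLin.symm (ContinuousLinearMap.toLinearMap f))
    b.sum_rankOne_eq_id
  simpa [ContinuousLinearMap.toLinearMap_sum, map_sum,
    InnerProductSpace.symm_toEuclideanLin_rankOne] using h

theorem ofReal_sqrt_mul_star_self {r : ℝ} (hr : 0 ≤ r) :
    (√r : 𝕜) * star (√r : 𝕜) = r := by
  rw [RCLike.star_def, RCLike.conj_ofReal, ← RCLike.ofReal_mul, Real.mul_self_sqrt hr]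

theorem exists_orthogonal_sum_vecKetBra {ρ : Matrix (m × n) (m × n) 𝕜} (hρ : ρ.PosSemidef) :
    ∃ (S : Finset (m × n)) (N : S → Matrix n m 𝕜), (∀ s, N s ≠ 0) ∧
      (Pairwise fun s t => ((N s)ᴴ * N t).trace = 0) ∧ ρ = ∑ s, vecKetBra (N s) := by
  classical
  let e := hρ.isHermitian.eigenvectorBasis
  let r := hρ.isHermitian.eigenvalues
  have hr (p) : (√(r p) : 𝕜) * star (√(r p) : 𝕜) = r p :=
    ofReal_sqrt_mul_star_self (hρ.eigenvalues_nonneg p)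
  choose N hN using fun p => vec_bijective.surjective ((√(r p) : 𝕜) • (e p).ofLp)
  have hterm (p) : vecKetBra (N p) = (r p : 𝕜) • vecMulVec (e p).ofLp (star (e p).ofLp) := by
    rw [vecKetBra, hN, star_smul, smul_vecMulVec, vecMulVec_smul, smul_smul, hr]
  have hsum : ρ = ∑ p, vecKetBra (N p) := by
    conv_lhs => rw [← mul_one ρ, ← sum_vecMulVec_orthonormalBasis e, Finset.mul_sum]
    refine Finset.sum_congr rfl fun p _ => ?_
    rw [hterm, mul_vecMulVec, hρ.isHermitian.mulVec_eigenvectorBasis,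
      ← RCLike.real_smul_eq_coe_smul, smul_vecMulVec]
  refine ⟨Finset.univ.filter (N · ≠ 0), fun p => N p, fun p => (Finset.mem_filter.1 p.2).2,
    fun p q hpq => ?_, ?_⟩
  · have horth : star (e p).ofLp ⬝ᵥ (e q).ofLp = 0 := by
      rw [dotProduct_comm, ← EuclideanSpace.inner_eq_star_dotProduct]
      exact e.orthonormal.2 (Subtype.coe_injective.ne hpq)
    change ((N p)ᴴ * N q).trace = 0
    rw [← star_vec_dotProduct_vec, hN, hN, star_smul, smul_dotProduct, dotProduct_smul, horth,
      smul_zero, smul_zero]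
  · rw [hsum, Finset.sum_coe_sort _ fun p => vecKetBra (N p), Finset.sum_filter_of_ne]
    rintro p - hp hNp
    exact hp (by rw [hNp, vecKetBra_zero])

end Ensembles

section Commutant

variable {n R : Type*} [CommRing R] [Fintype n] {Y : Matrix n n R} {u v u' v' : n → R}

theorem mulVec_eq_smul_of_commute (hY : Commute Y (vecMulVec u v)) (huv : v ⬝ᵥ u = 1) :
    Y *ᵥ u = (v ⬝ᵥ Y *ᵥ u) • u := by
  have h := congrArg (· *ᵥ u) hY.eq
  simpa [mul_vecMulVec, vecMulVec_mul, vecMulVec_mulVec, huv, ← dotProduct_mulVec] using h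

theorem vecMul_eq_smul_of_commute (hY : Commute Y (vecMulVec u v)) (huv : v ⬝ᵥ u = 1) :
    v ᵥ* Y = (v ⬝ᵥ Y *ᵥ u) • v := by
  have h := congrArg (v ᵥ* ·) hY.eq
  simpa [mul_vecMulVec, vecMulVec_mul, vecMul_vecMulVec, huv] using h.symm

theorem dotProduct_mulVec_eq_of_commute [IsDomain R] (hY : Commute Y (vecMulVec u v))
    (hY' : Commute Y (vecMulVec u' v')) (huv : v ⬝ᵥ u = 1) (huv' : v' ⬝ᵥ u' = 1)
    (h : v ⬝ᵥ u' ≠ 0) : v ⬝ᵥ Y *ᵥ u = v' ⬝ᵥ Y *ᵥ u' := by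
  refine mul_right_cancel₀ h ?_
  calc (v ⬝ᵥ Y *ᵥ u) * (v ⬝ᵥ u') = v ᵥ* Y ⬝ᵥ u' := by
        rw [vecMul_eq_smul_of_commute hY huv, smul_dotProduct, smul_eq_mul]
    _ = (v' ⬝ᵥ Y *ᵥ u') * (v ⬝ᵥ u') := by
        conv_lhs => rw [← dotProduct_mulVec, mulVec_eq_smul_of_commute hY' huv', dotProduct_smul,
          smul_eq_mul]

end Commutant

section BasisSets

variable {d m : ℕ}

theorem ketBra_eq_vecMulVec (ψ : EuclideanSpace ℂ (Fin d)) :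
    ketBra ψ = vecMulVec ψ.ofLp (star ψ.ofLp) := rfl

theorem posSemidef_ketBra (ψ : EuclideanSpace ℂ (Fin d)) : (ketBra ψ).PosSemidef :=
  posSemidef_vecMulVec_self_star _

theorem star_ofLp_dotProduct_ofLp (φ ψ : EuclideanSpace ℂ (Fin d)) :
    star φ.ofLp ⬝ᵥ ψ.ofLp = inner ℂ φ ψ := by
  rw [EuclideanSpace.inner_eq_star_dotProduct, dotProduct_comm]

variable (ψ : OrthonormalBasis (Fin d) ℂ (EuclideanSpace ℂ (Fin d)))

theorem star_ofLp_dotProduct_self (k : Fin d) : star (ψ k).ofLp ⬝ᵥ (ψ k).ofLp = 1 := by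
  rw [star_ofLp_dotProduct_ofLp, inner_self_eq_norm_sq_to_K, ψ.norm_eq_one, RCLike.ofReal_one,
    one_pow]

theorem ketBra_mul_self (k : Fin d) : ketBra (ψ k) * ketBra (ψ k) = ketBra (ψ k) := by
  rw [ketBra_eq_vecMulVec, vecMulVec_mul_vecMulVec, star_ofLp_dotProduct_self, one_smul]

theorem sum_ketBra : ∑ k, ketBra (ψ k) = 1 :=
  sum_vecMulVec_orthonormalBasis ψ

theorem sum_transpose_ketBra : ∑ k, (ketBra (ψ k))ᵀ = 1 := by
  rw [← transpose_sum, sum_ketBra, transpose_one]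

theorem IsIrreducibleBasisSet.exists_eq_smul_one {B : BasisSet m d} (hB : IsIrreducibleBasisSet B)
    {Y : Matrix (Fin d) (Fin d) ℂ} (hY : ∀ x k, Commute Y (ketBra (B x k))) :
    ∃ c : ℂ, Y = c • 1 := by
  let u (v : Fin m × Fin d) : Fin d → ℂ := (B v.1 v.2).ofLp
  let y (v : Fin m × Fin d) : ℂ := star (u v) ⬝ᵥ Y *ᵥ u v
  have hY' (v) : Commute Y (vecMulVec (u v) (star (u v))) := hY v.1 v.2
  have hu (v) : star (u v) ⬝ᵥ u v = 1 := star_ofLp_dotProduct_self (B v.1) v.2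
  have y_eq_of_adj {v w} (hvw : (transitionGraph B).Adj v w) : y v = y w :=
    dotProduct_mulVec_eq_of_commute (hY' v) (hY' w) (hu v) (hu w)
      (by rw [star_ofLp_dotProduct_ofLp]; exact hvw.2)
  obtain ⟨v₀⟩ := hB.nonempty
  have y_eq (v) : y v = y v₀ := by
    obtain ⟨p⟩ := hB.preconnected v v₀
    induction p with
    | nil => rfl
    | cons h _ ih => rw [y_eq_of_adj h, ih]
  refine ⟨y v₀, ?_⟩
  have mul_ketBra (k) : Y * ketBra (B v₀.1 k) = y v₀ • ketBra (B v₀.1 k) := by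
    rw [← y_eq (v₀.1, k), ketBra_eq_vecMulVec, mul_vecMulVec, ← smul_vecMulVec]
    exact congrArg (vecMulVec · _) (mulVec_eq_smul_of_commute (hY' (v₀.1, k)) (hu _))
  calc Y = ∑ k, Y * ketBra (B v₀.1 k) := by rw [← Finset.mul_sum, sum_ketBra, mul_one]
    _ = ∑ k, y v₀ • ketBra (B v₀.1 k) := Finset.sum_congr rfl fun k _ => mul_ketBra k
    _ = y v₀ • 1 := by rw [← Finset.smul_sum, sum_ketBra]

end BasisSets

section PerfectGuessing

theorem eq_zero_of_sum_sum_eq_sum_diag {ι M : Type*} [Fintype ι] [AddCommGroup M] [PartialOrder M]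
    [IsOrderedAddMonoid M] {p : ι → ι → M} (hp : ∀ k l, 0 ≤ p k l)
    (h : ∑ k, ∑ l, p k l = ∑ k, p k k) {k l : ι} (hkl : k ≠ l) : p k l = 0 := by
  classical
  have hoff (k) : ∑ l, p k l - p k k = ∑ l ∈ Finset.univ.erase k, p k l := by
    rw [← Finset.add_sum_erase _ (p k) (Finset.mem_univ k), add_sub_cancel_left]
  have hnonneg (k) : 0 ≤ ∑ l ∈ Finset.univ.erase k, p k l := Finset.sum_nonneg fun l _ => hp k l
  rw [← sub_eq_zero, ← Finset.sum_sub_distrib] at h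
  simp only [hoff] at h
  have hrow := (Finset.sum_eq_zero_iff_of_nonneg fun k _ => hnonneg k).1 h k (Finset.mem_univ k)
  exact (Finset.sum_eq_zero_iff_of_nonneg fun l _ => hp k l).1 hrow l
    (Finset.mem_erase.2 ⟨hkl.symm, Finset.mem_univ l⟩)

theorem mul_eq_mul_of_resolution {ι m n R : Type*} [Fintype ι] [Fintype m] [Fintype n]
    [DecidableEq m] [DecidableEq n] [NonAssocSemiring R]
    {P : ι → Matrix m m R} {E : ι → Matrix n n R} (hP : ∑ k, P k = 1) (hE : ∑ k, E k = 1)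
    {X : Matrix n m R} (h : ∀ k l, k ≠ l → E l * (X * P k) = 0) (l : ι) : E l * X = X * P l := by
  calc E l * X = ∑ k, E l * (X * P k) := by
        rw [← Matrix.mul_sum, ← Matrix.mul_sum, hP, Matrix.mul_one]
    _ = E l * (X * P l) := Finset.sum_eq_single l (fun k _ hk => h k l hk) (by simp)
    _ = ∑ k, E k * (X * P l) :=
        (Finset.sum_eq_single l (fun k _ hk => h l k hk.symm) (by simp)).symm
    _ = X * P l := by rw [← Matrix.sum_mul, hE, Matrix.one_mul]

theorem commute_conjTranspose_mul_of_mul_eq_mul {m n R : Type*} [Fintype m] [Fintype n]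
    [NonUnitalSemiring R] [StarRing R] {X Y : Matrix n m R} {E : Matrix n n R} {P : Matrix m m R}
    (hE : E.IsHermitian) (hP : P.IsHermitian) (hX : E * X = X * P) (hY : E * Y = Y * P) :
    Commute (Xᴴ * Y) P := by
  have hX' : Xᴴ * E = P * Xᴴ := by
    simpa only [conjTranspose_mul, hE.eq, hP.eq] using congrArg conjTranspose hX
  calc Xᴴ * Y * P = Xᴴ * E * Y := by rw [Matrix.mul_assoc, ← hY, Matrix.mul_assoc]
    _ = P * (Xᴴ * Y) := by rw [hX', Matrix.mul_assoc]

theorem sum_kronecker {ι l m n p R : Type*} [Fintype ι] [NonUnitalNonAssocSemiring R]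
    (A : ι → Matrix l m R) (B : Matrix n p R) : (∑ i, A i) ⊗ₖ B = ∑ i, A i ⊗ₖ B := by
  ext
  simp only [kroneckerMap_apply, Matrix.sum_apply, Finset.sum_mul]

theorem kronecker_sum {ι l m n p R : Type*} [Fintype ι] [NonUnitalNonAssocSemiring R]
    (A : Matrix l m R) (B : ι → Matrix n p R) : A ⊗ₖ (∑ i, B i) = ∑ i, A ⊗ₖ B i := by
  ext
  simp only [kroneckerMap_apply, Matrix.sum_apply, Finset.mul_sum]

variable {a b : ℕ} {ι : Type*} [Fintype ι] {N : ι → Matrix (Fin b) (Fin a) ℂ}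
  {ψ : OrthonormalBasis (Fin a) ℂ (EuclideanSpace ℂ (Fin a))}
  {E : Fin a → Matrix (Fin b) (Fin b) ℂ}

theorem mul_eq_mul_transpose_ketBra_of_guessProb_eq_trace (hE : IsPOVM E)
    (h : guessProb (∑ s, vecKetBra (N s)) ψ E = (∑ s, vecKetBra (N s)).trace) (l : Fin a) (s : ι) :
    E l * N s = N s * (ketBra (ψ l))ᵀ := by
  have heffect (k l) : (ketBra (ψ k) ⊗ₖ E l).PosSemidef := (posSemidef_ketBra _).kronecker (hE.1 l)
  let p (k l) : ℂ := ((∑ s, vecKetBra (N s)) * (ketBra (ψ k) ⊗ₖ E l)).trace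
  have hp (k l) : 0 ≤ p k l := by
    simp only [p, vecKetBra, trace_sum_vecMulVec_star_mul]
    exact Finset.sum_nonneg fun s _ => (heffect k l).dotProduct_mulVec_nonneg _
  have hsum : ∑ k, ∑ l, p k l = ∑ k, p k k := by
    refine Eq.trans ?_ h.symm
    simp only [p, ← trace_sum, ← Finset.mul_sum, ← kronecker_sum, ← sum_kronecker, sum_ketBra, hE.2,
      one_kronecker_one, mul_one]
  refine mul_eq_mul_of_resolution (sum_transpose_ketBra ψ) hE.2 (fun k l hkl => ?_) l
  have hzero := mulVec_eq_zero_of_trace_sum_mul_eq_zero (heffect k l)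
    (eq_zero_of_sum_sum_eq_sum_diag hp hsum hkl) s
  rwa [kronecker_mulVec_vec, vec_eq_zero_iff, Matrix.mul_assoc] at hzero

theorem guessProb_eq_trace_of_mul_eq_mul_transpose_ketBra
    (h : ∀ l s, E l * N s = N s * (ketBra (ψ l))ᵀ) :
    guessProb (∑ s, vecKetBra (N s)) ψ E = (∑ s, vecKetBra (N s)).trace := by
  have heffect (k s) : (ketBra (ψ k) ⊗ₖ E k) *ᵥ (N s).vec = (N s * (ketBra (ψ k))ᵀ).vec := by
    rw [kronecker_mulVec_vec, h, Matrix.mul_assoc, ← transpose_mul, ketBra_mul_self]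
  have htrace (k) : ((∑ s, vecKetBra (N s)) * (ketBra (ψ k) ⊗ₖ E k)).trace =
      ∑ s, star (N s).vec ⬝ᵥ (N s * (ketBra (ψ k))ᵀ).vec := by
    simp only [vecKetBra, trace_sum_vecMulVec_star_mul, heffect]
  simp only [guessProb, htrace]
  rw [Finset.sum_comm, trace_sum]
  refine Finset.sum_congr rfl fun s _ => ?_
  rw [← dotProduct_sum, ← vec_sum, ← Matrix.mul_sum, sum_transpose_ketBra, Matrix.mul_one,
    star_vec_dotProduct_vec, trace_vecKetBra]

end PerfectGuessing

section Isotropic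

variable {m n ι κ R : Type*} [CommRing R] [StarRing R] [Fintype n] [DecidableEq m]

/-- The Gram operators `(N s)ᴴ * N t` of a family are scalars. For the terms of an ensemble
decomposition of a state this says that all their superpositions are multiples of isometries. -/
def IsIsotropic (N : ι → Matrix n m R) : Prop :=
  ∀ s t, ∃ c : R, (N s)ᴴ * N t = c • 1

/-- Isometries with mutually orthogonal ranges. As bipartite vectors they are, up to normalization,
maximally entangled states that can be told apart on the second system. -/
structure OrthogonalIsometries (W : κ → Matrix n m R) : Prop where
  isometry : ∀ s, (W s)ᴴ * W s = 1
  orthogonal : Pairwise fun s t => (W s)ᴴ * W t = 0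

/-- The orthogonal projection onto the span of the ranges of a family of isometries with mutually
orthogonal ranges. -/
def rangeProjection [Fintype m] [Fintype κ] (W : κ → Matrix n m R) : Matrix n n R :=
  ∑ t, W t * (W t)ᴴ

namespace OrthogonalIsometries

variable [Fintype m] [Fintype κ] {W : κ → Matrix n m R}

theorem sum_mul_conjTranspose_mul {l : Type*} (hW : OrthogonalIsometries W) (X : κ → Matrix l m R)
    (s : κ) : (∑ t, X t * (W t)ᴴ) * W s = X s := by
  rw [Matrix.sum_mul, Finset.sum_eq_single s (fun t _ hts => ?_) (by simp), Matrix.mul_assoc,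
    hW.isometry, Matrix.mul_one]
  rw [Matrix.mul_assoc, hW.orthogonal hts, Matrix.mul_zero]

theorem isStarProjection_rangeProjection (hW : OrthogonalIsometries W) :
    IsStarProjection (rangeProjection W) where
  isIdempotentElem := by
    rw [IsIdempotentElem]
    conv_lhs => rw [rangeProjection, Matrix.mul_sum]
    simp only [← Matrix.mul_assoc, hW.sum_mul_conjTranspose_mul W]
    rfl
  isSelfAdjoint := by
    rw [rangeProjection, IsSelfAdjoint, star_eq_conjTranspose, conjTranspose_sum]
    simp only [conjTranspose_mul, conjTranspose_conjTranspose]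

theorem trace_sum_vecKetBra (hW : OrthogonalIsometries W) (z : κ → R) :
    (∑ s, vecKetBra (z s • W s)).trace = Fintype.card m * ∑ s, z s * star (z s) := by
  simp only [trace_sum, vecKetBra_smul, trace_smul, trace_vecKetBra, hW.isometry, trace_one,
    smul_eq_mul, Finset.mul_sum, mul_comm]

variable [DecidableEq n]

theorem one_sub_rangeProjection_mul (hW : OrthogonalIsometries W) (s : κ) :
    (1 - rangeProjection W) * W s = 0 := by
  rw [Matrix.sub_mul, Matrix.one_mul, rangeProjection, hW.sum_mul_conjTranspose_mul W, sub_self]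

end OrthogonalIsometries

end Isotropic

section IsotropicEnsembles

variable {m n ι 𝕜 : Type*} [RCLike 𝕜] [Fintype n] [DecidableEq m]

theorem exists_eq_smul_isometry [Finite m] {N : Matrix n m 𝕜} {c : 𝕜} (hN : N ≠ 0)
    (h : Nᴴ * N = c • 1) :
    ∃ (z : 𝕜) (W : Matrix n m 𝕜), z ≠ 0 ∧ Wᴴ * W = 1 ∧ N = z • W := by
  obtain ⟨i⟩ : Nonempty m := by
    by_contra hm
    rw [not_nonempty_iff] at hm
    exact hN (Subsingleton.elim _ _)
  obtain ⟨r, hr, rfl⟩ : ∃ r : ℝ, 0 ≤ r ∧ (r : 𝕜) = c := by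
    have hi := (posSemidef_conjTranspose_mul_self N).diag_nonneg (i := i)
    rw [h, Matrix.smul_apply, one_apply_eq, smul_eq_mul, mul_one] at hi
    exact RCLike.nonneg_iff_exists_ofReal.1 hi
  have hr0 : (r : 𝕜) ≠ 0 := by
    intro hr0
    rw [hr0, zero_smul, conjTranspose_mul_self_eq_zero] at h
    exact hN h
  have hz : (√r : 𝕜) * star (√r : 𝕜) = r := ofReal_sqrt_mul_star_self hr
  have hz0 : (√r : 𝕜) ≠ 0 := left_ne_zero_of_mul (hz.trans_ne hr0)
  refine ⟨√r, (√r : 𝕜)⁻¹ • N, hz0, ?_, by rw [smul_smul, mul_inv_cancel₀ hz0, one_smul]⟩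
  rw [conjTranspose_smul, Matrix.smul_mul, Matrix.mul_smul, h, smul_smul, smul_smul, star_inv₀,
    ← mul_inv, mul_comm (star _), hz, inv_mul_cancel₀ hr0, one_smul]

theorem IsIsotropic.exists_eq_smul_orthogonalIsometries [Fintype m] {N : ι → Matrix n m 𝕜}
    (hN : IsIsotropic N) (hN0 : ∀ s, N s ≠ 0)
    (horth : Pairwise fun s t => ((N s)ᴴ * N t).trace = 0) :
    ∃ (z : ι → 𝕜) (W : ι → Matrix n m 𝕜), OrthogonalIsometries W ∧ ∀ s, N s = z s • W s := by
  choose c hc using hN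
  choose z W hz hW hNW using fun s => exists_eq_smul_isometry (hN0 s) (hc s s)
  refine ⟨z, W, ⟨hW, fun s t hst => ?_⟩, hNW⟩
  have hgram : (N s)ᴴ * N t = 0 := by
    have htrace : ((N s)ᴴ * N t).trace = 0 := horth hst
    rcases isEmpty_or_nonempty m with hm | hm
    · exact Subsingleton.elim _ _
    · rw [hc, trace_smul, trace_one, smul_eq_mul, mul_eq_zero, Nat.cast_eq_zero] at htrace
      rw [hc, htrace.resolve_right Fintype.card_ne_zero, zero_smul]
  rw [hNW s, hNW t, conjTranspose_smul, Matrix.smul_mul, Matrix.mul_smul, smul_smul] at hgram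
  exact (smul_eq_zero.1 hgram).resolve_left (mul_ne_zero (star_ne_zero.2 (hz s)) (hz t))

theorem IsZUS.isIsotropic {k a b : ℕ} {B : BasisSet k a} [Fintype ι]
    {N : ι → Matrix (Fin b) (Fin a) ℂ} (h : IsZUS B (∑ s, vecKetBra (N s)))
    (hB : IsIrreducibleBasisSet B) (hN : (∑ s, vecKetBra (N s)).trace = 1) : IsIsotropic N := by
  intro s t
  have hcomm (x l) : Commute ((N s)ᴴ * N t)ᵀ (ketBra (B x l)) := by
    obtain ⟨E, hE, hg⟩ := h x
    have hmul := mul_eq_mul_transpose_ketBra_of_guessProb_eq_trace hE (hg.trans hN.symm) l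
    have := commute_conjTranspose_mul_of_mul_eq_mul (hE.1 l).isHermitian
      (posSemidef_ketBra (B x l)).isHermitian.transpose (hmul s) (hmul t)
    exact transpose_injective (by simpa using this.eq.symm)
  obtain ⟨c, hc⟩ := hB.exists_eq_smul_one hcomm
  exact ⟨c, transpose_injective (by rw [hc, transpose_smul, transpose_one])⟩

end IsotropicEnsembles

section OrthogonalIsometryMixtures

variable {a b : ℕ} {ρ : BipartiteOp a b}

/-- A mixture of maximally entangled vectors that Bob can tell apart: the canonical form shared by
zero-uncertainty states and maximally entangled states. The weights `|z s|²` carry the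
normalization of the `W s`, so they sum to `1 / a` if `ρ` is a state. -/
def IsOrthogonalIsometryMixture (ρ : BipartiteOp a b) : Prop :=
  ∃ (κ : Type) (_ : Fintype κ) (z : κ → ℂ) (W : κ → Matrix (Fin b) (Fin a) ℂ),
    OrthogonalIsometries W ∧ ρ = ∑ s, vecKetBra (z s • W s)

theorem isOrthogonalIsometryMixture_of_forall_isIsotropic (hρ : ρ.PosSemidef)
    (h : ∀ (κ : Type) [Fintype κ] (N : κ → Matrix (Fin b) (Fin a) ℂ),
      ρ = ∑ s, vecKetBra (N s) → IsIsotropic N) :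
    IsOrthogonalIsometryMixture ρ := by
  obtain ⟨S, N, hN0, horth, hρN⟩ := exists_orthogonal_sum_vecKetBra hρ
  obtain ⟨z, W, hW, hNW⟩ := (h S N hρN).exists_eq_smul_orthogonalIsometries hN0 horth
  exact ⟨S, inferInstance, z, W, hW, hρN.trans (by simp only [hNW])⟩

theorem IsZUS.isOrthogonalIsometryMixture {m : ℕ} {B : BasisSet m a} (h : IsZUS B ρ)
    (hB : IsIrreducibleBasisSet B) (hρ : IsState ρ) : IsOrthogonalIsometryMixture ρ := by
  refine isOrthogonalIsometryMixture_of_forall_isIsotropic hρ.1 fun κ _ N hN => ?_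
  subst hN
  exact h.isIsotropic hB hρ.2

theorem IsState.neZero (hρ : IsState ρ) : NeZero a := by
  refine ⟨?_⟩
  rintro rfl
  exact zero_ne_one ((trace_eq_zero_of_isEmpty ρ).symm.trans hρ.2)

theorem IsOrthogonalIsometryMixture.le (h : IsOrthogonalIsometryMixture ρ) (hρ : IsState ρ) :
    a ≤ b := by
  obtain ⟨κ, _, z, W, hW, rfl⟩ := h
  obtain ⟨s⟩ : Nonempty κ := by
    by_contra hκ
    rw [not_nonempty_iff] at hκ
    simpa using hρ.2
  have hrank := rank_mul_le_right (W s)ᴴ (W s)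
  rw [hW.isometry, rank_one, Fintype.card_fin] at hrank
  exact hrank.trans ((rank_le_card_height (W s)).trans_eq (Fintype.card_fin b))

theorem isPOVM_transpose_ketBra (ψ : OrthonormalBasis (Fin a) ℂ (EuclideanSpace ℂ (Fin a))) :
    IsPOVM fun k => (ketBra (ψ k))ᵀ :=
  ⟨fun k => (posSemidef_ketBra (ψ k)).transpose, sum_transpose_ketBra ψ⟩

open scoped MatrixOrder in
theorem OrthogonalIsometries.exists_isPOVM_mul_eq {κ : Type*} [Finite κ] {n : ℕ} [NeZero n]
    {W : κ → Matrix (Fin b) (Fin a) ℂ} (hW : OrthogonalIsometries W)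
    {P : Fin n → Matrix (Fin a) (Fin a) ℂ} (hP : IsPOVM P) :
    ∃ E : Fin n → Matrix (Fin b) (Fin b) ℂ, IsPOVM E ∧ ∀ l s, E l * W s = W s * P l := by
  have := Fintype.ofFinite κ
  have hcompl : (1 - rangeProjection W).PosSemidef :=
    nonneg_iff_posSemidef.1 hW.isStarProjection_rangeProjection.one_sub.nonneg
  let G : Fin n → Matrix (Fin b) (Fin b) ℂ := Pi.single 0 (1 - rangeProjection W)
  have hG (l) : (G l).PosSemidef ∧ ∀ s, G l * W s = 0 := by
    simp only [G, Pi.single_apply]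
    split_ifs
    exacts [⟨hcompl, hW.one_sub_rangeProjection_mul⟩, ⟨.zero, fun _ => Matrix.zero_mul _⟩]
  refine ⟨fun l => ∑ t, W t * P l * (W t)ᴴ + G l, ⟨fun l => ?_, ?_⟩, fun l s => ?_⟩
  · exact (posSemidef_sum _ fun t _ => (hP.1 l).mul_mul_conjTranspose_same (W t)).add (hG l).1
  · rw [Finset.sum_add_distrib, Fintype.sum_pi_single', Finset.sum_comm]
    simp only [← Matrix.sum_mul, ← Matrix.mul_sum, hP.2, Matrix.mul_one]
    exact add_sub_cancel _ _
  · rw [Matrix.add_mul, hW.sum_mul_conjTranspose_mul, (hG l).2, add_zero]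

theorem IsOrthogonalIsometryMixture.isZUS {m : ℕ} (h : IsOrthogonalIsometryMixture ρ)
    (hρ : IsState ρ) (B : BasisSet m a) : IsZUS B ρ := by
  intro x
  have := hρ.neZero
  obtain ⟨κ, _, z, W, hW, rfl⟩ := h
  obtain ⟨E, hE, hEW⟩ := hW.exists_isPOVM_mul_eq (isPOVM_transpose_ketBra (B x))
  refine ⟨E, hE, ?_⟩
  rw [guessProb_eq_trace_of_mul_eq_mul_transpose_ketBra fun l s => by
    rw [Matrix.mul_smul, hEW, Matrix.smul_mul], hρ.2]

end OrthogonalIsometryMixtures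

section Separable

variable {a b c d : ℕ}

/-- A separable map: a completely positive trace-preserving map all of whose Kraus operators are
tensor products. This relaxation of LOCC loses the order of communication. -/
def IsSeparableMap (T : BipartiteOp a b → BipartiteOp c d) : Prop :=
  ∃ (ι : Type) (_ : Fintype ι) (A : ι → Matrix (Fin c) (Fin a) ℂ)
    (K : ι → Matrix (Fin d) (Fin b) ℂ),
    ∑ i, (A i ⊗ₖ K i)ᴴ * (A i ⊗ₖ K i) = 1 ∧ ∀ ρ, T ρ = ∑ i, (A i ⊗ₖ K i) * ρ * (A i ⊗ₖ K i)ᴴ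

theorem isSeparableMap_id : IsSeparableMap fun ρ : BipartiteOp a b => ρ :=
  ⟨Unit, inferInstance, fun _ => 1, fun _ => 1, by simp, by simp⟩

theorem IsSeparableMap.sum_conj {ι : Type} [Fintype ι] {p q : ι → ℕ}
    {T : (i : ι) → BipartiteOp (p i) (q i) → BipartiteOp c d} (hT : ∀ i, IsSeparableMap (T i))
    {L : (i : ι) → Matrix (Fin (p i)) (Fin a) ℂ} {M : (i : ι) → Matrix (Fin (q i)) (Fin b) ℂ}
    (hLM : ∑ i, (L i ⊗ₖ M i)ᴴ * (L i ⊗ₖ M i) = 1) :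
    IsSeparableMap fun ρ : BipartiteOp a b => ∑ i, T i ((L i ⊗ₖ M i) * ρ * (L i ⊗ₖ M i)ᴴ) := by
  choose κ hκ A K hAK hTeq using hT
  refine ⟨Σ i, κ i, inferInstance, fun j => A j.1 j.2 * L j.1, fun j => K j.1 j.2 * M j.1, ?_,
    fun ρ => ?_⟩
  · rw [Fintype.sum_sigma, ← hLM]
    refine Finset.sum_congr rfl fun i _ => ?_
    calc ∑ j, ((A i j * L i) ⊗ₖ (K i j * M i))ᴴ * ((A i j * L i) ⊗ₖ (K i j * M i))
        = (L i ⊗ₖ M i)ᴴ * (∑ j, (A i j ⊗ₖ K i j)ᴴ * (A i j ⊗ₖ K i j)) * (L i ⊗ₖ M i) := by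
          simp only [mul_kronecker_mul, conjTranspose_mul, Matrix.mul_sum, Matrix.sum_mul,
            Matrix.mul_assoc]
      _ = (L i ⊗ₖ M i)ᴴ * (L i ⊗ₖ M i) := by rw [hAK, Matrix.mul_one]
  · simp only [Fintype.sum_sigma, hTeq, mul_kronecker_mul, conjTranspose_mul, Matrix.mul_assoc]

theorem IsLOCC.isSeparableMap {T : BipartiteOp a b → BipartiteOp c d} (hT : IsLOCC T) :
    IsSeparableMap T := by
  induction hT with
  | done => exact isSeparableMap_id
  | @alice a b n dim L hL T _ ih =>
    refine IsSeparableMap.sum_conj ih ?_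
    simp only [conjTranspose_kronecker, ← mul_kronecker_mul, conjTranspose_one, mul_one,
      ← sum_kronecker, hL, one_kronecker_one]
  | @bob a b n dim L hL T _ ih =>
    refine IsSeparableMap.sum_conj ih ?_
    simp only [conjTranspose_kronecker, ← mul_kronecker_mul, conjTranspose_one, mul_one,
      ← kronecker_sum, hL, one_kronecker_one]

end Separable

section Extremality

variable {m n p ι κ R : Type*} [Fintype m] [Fintype n] [Fintype p]

theorem mul_eq_smul_one_of_mul_eq_smul_one [Field R] [DecidableEq m] {P X Y : Matrix m m R}
    {c d : R} (hd : d ≠ 0) (hY : P * Y = d • 1) (hX : P * X = c • 1) : X * P = c • 1 := by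
  have hinv : (d⁻¹ • Y) * P = 1 := by
    rw [mul_eq_one_comm, Matrix.mul_smul, hY, smul_smul, inv_mul_cancel₀ hd, one_smul]
  calc X * P = (d⁻¹ • Y) * (P * X) * P := by rw [← Matrix.mul_assoc (d⁻¹ • Y), hinv, Matrix.one_mul]
    _ = c • 1 := by rw [hX, Matrix.mul_smul, Matrix.mul_one, Matrix.smul_mul, hinv]

theorem sum_conjTranspose_mul_mul_transpose [CommRing R] [StarRing R] [Fintype κ] [DecidableEq m]
    [DecidableEq n] {A : κ → Matrix m m R} {K : κ → Matrix p n R}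
    (hAK : ∑ i, (A i ⊗ₖ K i)ᴴ * (A i ⊗ₖ K i) = 1) (X : Matrix n m R) :
    ∑ i, (K i)ᴴ * (K i * X * (A i)ᵀ) * ((A i)ᵀ)ᴴ = X := by
  apply vec_bijective.injective
  calc (∑ i, (K i)ᴴ * (K i * X * (A i)ᵀ) * ((A i)ᵀ)ᴴ).vec
      = (∑ i, (A i ⊗ₖ K i)ᴴ * (A i ⊗ₖ K i)) *ᵥ X.vec := by
        simp only [vec_sum, sum_mulVec, ← mulVec_mulVec, conjTranspose_kronecker,
          kronecker_mulVec_vec]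
        rfl
    _ = X.vec := by rw [hAK, one_mulVec]

theorem isIsotropic_of_mul_mul_transpose_eq_smul [Field R] [StarRing R] [Fintype κ] [DecidableEq m]
    [DecidableEq n] {A : κ → Matrix m m R} {K : κ → Matrix p n R}
    (hAK : ∑ i, (A i ⊗ₖ K i)ᴴ * (A i ⊗ₖ K i) = 1) {N : ι → Matrix n m R} {J : Matrix p m R}
    {z : κ → ι → R} (hJ : Jᴴ * J = 1) (hN : ∀ i s, K i * N s * (A i)ᵀ = z i s • J) :
    IsIsotropic N := by
  intro s t
  have hP (i s) : ((A i)ᵀ)ᴴ * ((K i * N s)ᴴ * J) = star (z i s) • 1 := by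
    rw [← Matrix.mul_assoc, ← conjTranspose_mul, hN, conjTranspose_smul, Matrix.smul_mul, hJ]
  have hterm (i) : (N s)ᴴ * ((K i)ᴴ * (K i * N t * (A i)ᵀ) * ((A i)ᵀ)ᴴ) =
      (z i t * star (z i s)) • 1 := by
    have hcommute : z i t • ((K i * N s)ᴴ * J * ((A i)ᵀ)ᴴ) = z i t • star (z i s) • 1 := by
      by_cases hz : z i t = 0
      · rw [hz, zero_smul, zero_smul]
      · rw [mul_eq_smul_one_of_mul_eq_smul_one (star_ne_zero.2 hz) (hP i t) (hP i s)]
    rw [hN, ← smul_smul, ← hcommute, conjTranspose_mul]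
    simp only [Matrix.mul_smul, Matrix.smul_mul, Matrix.mul_assoc]
  refine ⟨∑ i, z i t * star (z i s), ?_⟩
  conv_lhs => rw [← sum_conjTranspose_mul_mul_transpose hAK (N t)]
  rw [Matrix.mul_sum, Finset.sum_smul]
  exact Finset.sum_congr rfl fun i _ => hterm i

theorem exists_conjTranspose_mul_self_eq_one [NonAssocSemiring R] [StarRing R] [DecidableEq m]
    (h : Fintype.card m ≤ Fintype.card n) : ∃ J : Matrix n m R, Jᴴ * J = 1 := by
  classical
  obtain ⟨f⟩ := Function.Embedding.nonempty_of_card_le h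
  refine ⟨(1 : Matrix n n R).submatrix id f, ?_⟩
  rw [conjTranspose_submatrix, conjTranspose_one, ← submatrix_mul _ _ _ id _ Function.bijective_id,
    Matrix.one_mul, submatrix_one _ f.injective]

end Extremality

section MaximallyEntangled

variable {a b : ℕ}

theorem isState_inv_smul_vecKetBra [NeZero a] {J : Matrix (Fin b) (Fin a) ℂ} (hJ : Jᴴ * J = 1) :
    IsState ((a : ℂ)⁻¹ • vecKetBra J) := by
  refine ⟨(posSemidef_vecMulVec_self_star _).smul (inv_nonneg.2 (Nat.cast_nonneg a)), ?_⟩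
  rw [trace_smul, trace_vecKetBra, hJ, trace_one, Fintype.card_fin, smul_eq_mul,
    inv_mul_cancel₀ (Nat.cast_ne_zero.2 (NeZero.ne a))]

theorem IsMES.isIsotropic {ι : Type*} [Fintype ι] {N : ι → Matrix (Fin b) (Fin a) ℂ}
    (h : IsMES (∑ s, vecKetBra (N s))) (hab : a ≤ b) : IsIsotropic N := by
  have := h.1.neZero
  obtain ⟨J, hJ⟩ : ∃ J : Matrix (Fin b) (Fin a) ℂ, Jᴴ * J = 1 :=
    exists_conjTranspose_mul_self_eq_one (by simpa using hab)
  obtain ⟨T, hT, hTJ⟩ := h.2 _ (isState_inv_smul_vecKetBra hJ)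
  obtain ⟨κ, _, A, K, hAK, hTeq⟩ := hT.isSeparableMap
  have hsum : ∑ q : κ × ι, vecKetBra (K q.1 * N q.2 * (A q.1)ᵀ) = (a : ℂ)⁻¹ • vecKetBra J := by
    rw [← hTJ, hTeq, Fintype.sum_prod_type]
    simp only [Matrix.mul_sum, Matrix.sum_mul, kronecker_mul_vecKetBra_mul]
  choose z hz using exists_eq_smul_of_sum_vecMulVec_eq hsum
  exact isIsotropic_of_mul_mul_transpose_eq_smul (z := fun i s => z (i, s)) hAK hJ
    fun i s => vec_bijective.injective (hz (i, s))

theorem IsMES.isOrthogonalIsometryMixture {ρ : BipartiteOp a b} (h : IsMES ρ) (hab : a ≤ b) :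
    IsOrthogonalIsometryMixture ρ := by
  refine isOrthogonalIsometryMixture_of_forall_isIsotropic h.1.1 fun κ _ N hN => ?_
  subst hN
  exact h.isIsotropic hab

end MaximallyEntangled

section WeylOperators

variable {G : Type*} [AddCommGroup G] [Fintype G] [DecidableEq G]

/-- The Weyl operator of a group element and a character: the character acts as a phase, followed
by the translation. The Weyl operators are the unitary corrections in teleportation. -/
def weylOperator (j : G × AddChar G ℂ) : Matrix G G ℂ :=
  of fun i k => if i = k + j.1 then j.2 k else 0

theorem conjTranspose_weylOperator_mul_mul_apply (j : G × AddChar G ℂ) (X : Matrix G G ℂ)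
    (k l : G) :
    ((weylOperator j)ᴴ * X * weylOperator j) k l = X (k + j.1) (l + j.1) * j.2 (l - k) := by
  simp only [weylOperator, mul_apply, conjTranspose_apply, of_apply, apply_ite star, star_zero,
    mul_ite, ite_mul, zero_mul, mul_zero, Finset.sum_ite_eq', Finset.mem_univ, if_true]
  rw [sub_eq_neg_add, AddChar.map_add_eq_mul, AddChar.map_neg_eq_conj, starRingEnd_apply]
  ring

theorem conjTranspose_weylOperator_mul_self (j : G × AddChar G ℂ) :
    (weylOperator j)ᴴ * weylOperator j = 1 := by
  ext k l
  rw [← Matrix.mul_one (weylOperator j)ᴴ, conjTranspose_weylOperator_mul_mul_apply]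
  rcases eq_or_ne k l with rfl | hkl
  · rw [one_apply_eq, one_apply_eq, sub_self, AddChar.map_zero_eq_one, one_mul]
  · rw [one_apply_ne hkl, one_apply_ne (add_left_injective _ |>.ne hkl), zero_mul]

theorem sum_conjTranspose_weylOperator_mul_mul (X : Matrix G G ℂ) :
    ∑ j, (weylOperator j)ᴴ * X * weylOperator j = (Fintype.card G * X.trace : ℂ) • 1 := by
  ext k l
  simp only [Matrix.sum_apply, conjTranspose_weylOperator_mul_mul_apply, Fintype.sum_prod_type,
    ← Finset.mul_sum, AddChar.sum_apply_eq_ite, sub_eq_zero, Matrix.smul_apply, one_apply,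
    eq_comm (a := l), smul_eq_mul, mul_ite, mul_one, mul_zero]
  split_ifs with hkl
  · rw [← hkl, ← Finset.sum_mul, mul_comm, trace]
    congr 1
    exact Equiv.sum_comp (Equiv.addLeft k) X.diag
  · exact Finset.sum_const_zero

theorem sum_conjTranspose_mul_weylOperator_mul_self {n ι : Type*} [Fintype n] [Fintype ι]
    (Y : ι → Matrix n G ℂ) :
    ∑ p : ι × G × AddChar G ℂ, (Y p.1 * weylOperator p.2)ᴴ * (Y p.1 * weylOperator p.2) =
      (Fintype.card G * (∑ q, vecKetBra (Y q)).trace) • 1 := by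
  rw [Fintype.sum_prod_type, trace_sum, Finset.mul_sum, Finset.sum_smul]
  refine Finset.sum_congr rfl fun q _ => ?_
  rw [trace_vecKetBra, ← sum_conjTranspose_weylOperator_mul_mul]
  simp only [conjTranspose_mul, Matrix.mul_assoc]

end WeylOperators

section Teleportation

variable {a b : ℕ}

theorem isLOCC_sum_isometry_kronecker {c d : ℕ} {ι : Type*} [Fintype ι]
    {U : ι → Matrix (Fin c) (Fin a) ℂ} {K : ι → Matrix (Fin d) (Fin b) ℂ}
    (hU : ∀ i, (U i)ᴴ * U i = 1) (hK : ∑ i, (K i)ᴴ * K i = 1) :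
    IsLOCC fun ρ : BipartiteOp a b => ∑ i, (U i ⊗ₖ K i) * ρ * (U i ⊗ₖ K i)ᴴ := by
  let e := Fintype.equivFin ι
  have hbob : ∑ j, (K (e.symm j))ᴴ * K (e.symm j) = 1 := by
    rw [← hK, e.symm.sum_comp fun i => (K i)ᴴ * K i]
  have halice (j) : ∑ _ : Fin 1, (U (e.symm j))ᴴ * U (e.symm j) = 1 := by
    rw [Fin.sum_univ_one, hU]
  convert IsLOCC.bob (fun _ => d) (fun j => K (e.symm j)) hbob _ fun j =>
    IsLOCC.alice (fun _ => c) (fun _ => U (e.symm j)) (halice j) _ fun _ => .done using 2 with ρ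
  rw [← e.symm.sum_comp]
  refine Finset.sum_congr rfl fun j _ => ?_
  have hUK : U (e.symm j) ⊗ₖ K (e.symm j) =
      (U (e.symm j) ⊗ₖ (1 : Matrix (Fin d) (Fin d) ℂ)) *
        ((1 : Matrix (Fin a) (Fin a) ℂ) ⊗ₖ K (e.symm j)) := by
    rw [← mul_kronecker_mul, Matrix.mul_one, Matrix.one_mul]
  rw [hUK, conjTranspose_mul]
  simp only [Fin.sum_univ_one, Matrix.mul_assoc]

namespace OrthogonalIsometries

variable {κ ι m n R : Type*} [CommRing R] [StarRing R] [Fintype κ] [Fintype m] [Fintype n]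
  [DecidableEq m] {W : κ → Matrix n m R}

theorem conjTranspose_mul_self_one_sub_add_sum [Fintype ι] [DecidableEq n] {l : Type*} [Fintype l]
    (hW : OrthogonalIsometries W) {L : ι → Matrix l m R} (hL : ∑ i, (L i)ᴴ * L i = 1) :
    (1 - rangeProjection W)ᴴ * (1 - rangeProjection W) +
      ∑ p : κ × ι, (L p.2 * (W p.1)ᴴ)ᴴ * (L p.2 * (W p.1)ᴴ) = 1 := by
  have hproj := hW.isStarProjection_rangeProjection.one_sub
  have hrange (t) : ∑ i, (L i * (W t)ᴴ)ᴴ * (L i * (W t)ᴴ) = W t * (W t)ᴴ := by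
    calc ∑ i, (L i * (W t)ᴴ)ᴴ * (L i * (W t)ᴴ) = W t * (∑ i, (L i)ᴴ * L i) * (W t)ᴴ := by
          simp only [conjTranspose_mul, conjTranspose_conjTranspose, Matrix.mul_sum,
            Matrix.sum_mul, Matrix.mul_assoc]
      _ = W t * (W t)ᴴ := by rw [hL, Matrix.mul_one]
  rw [← star_eq_conjTranspose, hproj.isSelfAdjoint, hproj.isIdempotentElem, Fintype.sum_prod_type]
  simp only [hrange]
  exact sub_add_cancel _ _

theorem sum_vecKetBra_mul_conjTranspose_mul {k l : Type*} (hW : OrthogonalIsometries W)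
    (z : κ → R) (X : Matrix l m R) (Y : Matrix m k R) (t : κ) :
    ∑ s, vecKetBra (X * (W t)ᴴ * (z s • W s) * Y) = (z t * star (z t)) • vecKetBra (X * Y) := by
  rw [Finset.sum_eq_single t (fun s _ hst => ?_) (by simp)]
  · rw [Matrix.mul_smul, Matrix.mul_assoc X, hW.isometry, Matrix.mul_one, Matrix.smul_mul,
      vecKetBra_smul]
  · rw [Matrix.mul_smul, Matrix.mul_assoc X, hW.orthogonal hst.symm, Matrix.mul_zero, smul_zero,
      Matrix.zero_mul, vecKetBra_zero]

end OrthogonalIsometries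

theorem OrthogonalIsometries.exists_isLOCC {κ ι : Type*} [Fintype κ] [Fintype ι]
    {W : κ → Matrix (Fin b) (Fin a) ℂ} (hW : OrthogonalIsometries W)
    {L : ι → Matrix (Fin b) (Fin a) ℂ} (hL : ∑ i, (L i)ᴴ * L i = 1)
    {U : ι → Matrix (Fin a) (Fin a) ℂ} (hU : ∀ i, (U i)ᴴ * U i = 1) (z : κ → ℂ) :
    ∃ T : BipartiteOp a b → BipartiteOp a b, IsLOCC T ∧
      T (∑ s, vecKetBra (z s • W s)) =
        (∑ s, z s * star (z s)) • ∑ i, vecKetBra (L i * (U i)ᵀ) := by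
  let V : Option (κ × ι) → Matrix (Fin a) (Fin a) ℂ := fun o => o.elim 1 fun p => U p.2
  let K : Option (κ × ι) → Matrix (Fin b) (Fin b) ℂ :=
    fun o => o.elim (1 - rangeProjection W) fun p => L p.2 * (W p.1)ᴴ
  have hV (o) : (V o)ᴴ * V o = 1 := by
    rcases o with _ | p
    · simp only [V, Option.elim, conjTranspose_one, Matrix.one_mul]
    · exact hU p.2
  have hK : ∑ o, (K o)ᴴ * K o = 1 := by
    rw [Fintype.sum_option]
    exact hW.conjTranspose_mul_self_one_sub_add_sum hL
  have hnone : ∑ s, vecKetBra (K none * (z s • W s) * (V none)ᵀ) = 0 := by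
    refine Finset.sum_eq_zero fun s _ => ?_
    rw [Matrix.mul_smul, show K none * W s = 0 from hW.one_sub_rangeProjection_mul s, smul_zero,
      Matrix.zero_mul, vecKetBra_zero]
  have hsome (t i) : ∑ s, vecKetBra (K (some (t, i)) * (z s • W s) * (V (some (t, i)))ᵀ) =
      (z t * star (z t)) • vecKetBra (L i * (U i)ᵀ) :=
    hW.sum_vecKetBra_mul_conjTranspose_mul z (L i) (U i)ᵀ t
  refine ⟨_, isLOCC_sum_isometry_kronecker hV hK, ?_⟩
  rw [Finset.sum_smul]
  simp only [Matrix.mul_sum, Matrix.sum_mul, kronecker_mul_vecKetBra_mul, Fintype.sum_option,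
    Fintype.sum_prod_type, hnone, hsome, zero_add, Finset.smul_sum]

theorem IsState.exists_sum_vecKetBra_mul_transpose_eq_smul {σ : BipartiteOp a b}
    (hσ : IsState σ) :
    ∃ (ι : Type) (_ : Fintype ι) (L : ι → Matrix (Fin b) (Fin a) ℂ)
      (U : ι → Matrix (Fin a) (Fin a) ℂ), ∑ i, (L i)ᴴ * L i = 1 ∧ (∀ i, (U i)ᴴ * U i = 1) ∧
        ∑ i, vecKetBra (L i * (U i)ᵀ) = (a : ℂ) • σ := by
  have := hσ.neZero
  have ha : (a : ℂ) ≠ 0 := Nat.cast_ne_zero.2 (NeZero.ne a)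
  obtain ⟨S, Y, -, -, hY⟩ := exists_orthogonal_sum_vecKetBra
    (hσ.1.smul (inv_nonneg.2 (Nat.cast_nonneg a) : (0 : ℂ) ≤ (a : ℂ)⁻¹))
  -- Alice's correction `((weylOperator p.2)ᴴ)ᵀ` cancels Bob's Weyl operator in every branch.
  refine ⟨S × Fin a × AddChar (Fin a) ℂ, inferInstance, fun p => Y p.1 * weylOperator p.2,
    fun p => ((weylOperator p.2)ᴴ)ᵀ, ?_, fun p => ?_, ?_⟩
  · rw [sum_conjTranspose_mul_weylOperator_mul_self, ← hY, trace_smul, hσ.2, Fintype.card_fin,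
      smul_eq_mul, mul_one, mul_inv_cancel₀ ha, one_smul]
  · rw [conjTranspose_transpose_eq_transpose_conjTranspose, conjTranspose_conjTranspose,
      ← transpose_mul, conjTranspose_weylOperator_mul_self, transpose_one]
  · have hbranch (p : S × Fin a × AddChar (Fin a) ℂ) :
        Y p.1 * weylOperator p.2 * (((weylOperator p.2)ᴴ)ᵀ)ᵀ = Y p.1 := by
      rw [transpose_transpose, Matrix.mul_assoc,
        mul_eq_one_comm.1 (conjTranspose_weylOperator_mul_self p.2), Matrix.mul_one]
    simp only [hbranch]
    calc ∑ p : S × Fin a × AddChar (Fin a) ℂ, vecKetBra (Y p.1)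
        = ((a : ℂ) * a) • ∑ q, vecKetBra (Y q) := by
          simp [Fintype.sum_prod_type, Finset.smul_sum, ← Nat.cast_smul_eq_nsmul ℂ]
      _ = (a : ℂ) • σ := by rw [← hY, smul_smul, mul_assoc, mul_inv_cancel₀ ha, mul_one]

theorem IsOrthogonalIsometryMixture.isMES {ρ : BipartiteOp a b}
    (h : IsOrthogonalIsometryMixture ρ) (hρ : IsState ρ) : IsMES ρ := by
  refine ⟨hρ, fun σ hσ => ?_⟩
  obtain ⟨κ, _, z, W, hW, rfl⟩ := h
  obtain ⟨ι, _, L, U, hL, hU, hσLU⟩ := hσ.exists_sum_vecKetBra_mul_transpose_eq_smul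
  have hz : a * ∑ s, z s * star (z s) = 1 := by
    rw [← hρ.2, hW.trace_sum_vecKetBra, Fintype.card_fin]
  obtain ⟨T, hT, hTρ⟩ := hW.exists_isLOCC hL hU z
  exact ⟨T, hT, by rw [hTρ, hσLU, smul_smul, mul_comm, hz, one_smul]⟩

end Teleportation

theorem theorem1 {m dA dB : ℕ} (B : BasisSet m dA) (hB : IsIrreducibleBasisSet B)
    (ρ : BipartiteOp dA dB) (hρ : IsState ρ) :
    IsZUS B ρ ↔ dA ≤ dB ∧ IsMES ρ := by
  constructor
  · intro hzus
    have hmix := hzus.isOrthogonalIsometryMixture hB hρ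
    exact ⟨hmix.le hρ, hmix.isMES hρ⟩
  · rintro ⟨hle, hmes⟩
    exact (hmes.isOrthogonalIsometryMixture hle).isZUS hρ B
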